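/- Let $n\ge 2$ and $q_{12},q_{21},\lambda>0$. A source $Q(t)\in\{1,2\}$ is a continuous-time Markov chain with transition rates $q_{12}$ (from $1$ to $2$) and $q_{21}$ (from $2$ to $1$), and stationary distribution $\pi_1=\frac{q_{21}}{q_{12}+q_{21}}$, $\pi_2=\frac{q_{12}}{q_{12}+q_{21}}$. Its version number increases by one at each transition. Each of $n$ nodes stores a packet consisting of a version number and a content in $\{1,2\}$. For a push rate $\lambda_s>0$, independently of the source and of each other: at rate $\lambda_s/n$ for each node $j$, the source replaces the packet of $j$ by its current version and state; at rate $\lambda/(n-1)$ for each ordered pair $(i,j)$ of distinct nodes, node $i$ sends its packet to node $j$, which adopts it if and only if its version is larger than that of the packet held by $j$. The initial state may be random, provided that almost surely no stored version exceeds that of the source, stored packets of equal version have equal content, and a stored packet of the source's version has the source's state as content. For a nonempty set $A$ of nodes let $C_A(t)$ be the fraction of the nodes of $A$ whose content equals $Q(t)$, and let $F_A(t)\in\{0,1\}$ indicate whether the content of a node in $A$ of largest version equals $Q(t)$. Then the following holds. 1. For every $\lambda_s>0$ and $m\in\{1,2\}$ the limits $c^{(m)}=\lim_{t\to\infty}\mathbb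 E[C_A(t)\mathbf 1_{\{Q(t)=m\}}]$ for nonempty $A$, and $f_2^{(m)}=\lim_{t\to\infty}\mathbb E[F_A(t)\mathbf 1_{\{Q(t)=m\}}]$ for $|A|=2$, exist and depend neither on $A$ nor on the initial law. Write $\mathbf c=(c^{(1)},c^{(2)})^T$, $\mathbf f_2=(f_2^{(1)},f_2^{(2)})^T$, and $c=\lim_{t\to\infty}\mathbb E[C_A(t)]=c^{(1)}+c^{(2)}$. 2. As $\lambda_s\to0^+$ with $\lambda$ fixed, $\mathbf f_2$ converges to a limit $\mathbf f_{2,0}$, and $\mathbf f_{2,0}=\mathbf g_2$, where $\mathbf g_n=\frac{1}{(q_{12}+q_{21})^2}\begin{bmatrix}q_{21}^2\\ q_{12}^2\end{bmatrix}$ and, for $2\le k\le n-1$ and $\beta_k=\frac{k(n-k)\lambda}{n-1}$, $$\begin{bmatrix}q_{12}+\beta_k&q_{21}\\ q_{12}&q_{21}+\beta_k\end{bmatrix}\mathbf g_k=\begin{bmatrix}q_{21}\pi_2\\ q_{12}\pi_1\end{bmatrix}+\beta_k\,\mathbf g_{k+1}.$$ 3. As $\lambda_s\to0^+$ with $\lambda$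 fixed, $\mathbf c$ converges to a vector $\mathbf c_0$, which is the unique solution of $$\begin{bmatrix}q_{12}+\lambda&q_{21}\\ q_{12}&q_{21}+\lambda\end{bmatrix}\mathbf c_0=\begin{bmatrix}q_{21}\pi_2\\ q_{12}\pi_1\end{bmatrix}+\lambda\,\mathbf f_{2,0},$$ and consequently $c\to c_0^{(1)}+c_0^{(2)}$. -/

import Mathlib

open Filter Topology MeasureTheory

namespace GossipNetwork

/-- State of a network of `n` nodes with a binary source. The source states `1`, `2` are
`0 1 : Fin 2`. -/
@[ext] structure NetState (n : ℕ) where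
  /-- current source state `Q` -/
  mode : Fin 2
  /-- current source version `V₀` -/
  srcVersion : ℕ
  /-- version `V_i` of the packet held by node `i` -/
  version : Fin n → ℕ
  /-- content `S_i` of the packet held by node `i` -/
  content : Fin n → Fin 2

instance (n : ℕ) : MeasurableSpace (NetState n) := ⊤

/-- Events: the two source flips, the source pushing to node `j`, and node `i` sending its packet
to node `j`. -/
inductive Event (n : ℕ) where
  | flip12 : Event n
  | flip21 : Event n
  | push (j : Fin n) : Event n
  | gossip (i j : Fin n) : Event n
  deriving DecidableEq, Fintype

/-- Effect of an event. A flip clock does nothing when the source is in the other mode. On gossip,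
the receiver accepts the packet exactly when it has a newer version. -/
def Event.apply {n : ℕ} : Event n → NetState n → NetState n
  | .flip12, z => if z.mode = 0 then { z with mode := 1, srcVersion := z.srcVersion + 1 } else z
  | .flip21, z => if z.mode = 1 then { z with mode := 0, srcVersion := z.srcVersion + 1 } else z
  | .push j, z => { z with
      version := Function.update z.version j z.srcVersion
      content := Function.update z.content j z.mode }
  | .gossip i j, z => if z.version j < z.version i then { z with
      version := Function.update z.version j (z.version i)
      content := Function.update z.content j (z.content i) } else z

/-- Rates of the independent Poisson clocks driving the events (there is no self-gossip). -/
noncomputable def Event.rate {n : ℕ} (q12 q21 lam ls : ℝ) : Event n → ℝ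
  | .flip12 => q12
  | .flip21 => q21
  | .push _ => ls / n
  | .gossip i j => if i = j then 0 else lam / ((n : ℝ) - 1)

/-- Total rate of all clocks. -/
noncomputable def totalRate (n : ℕ) (q12 q21 lam ls : ℝ) : ℝ :=
  ∑ e : Event n, e.rate q12 q21 lam ls

/-- Law of the state after one more tick of the superposed clocks: the tick is of type `e` with
probability `rate e / totalRate`. -/
noncomputable def tick {n : ℕ} (q12 q21 lam ls : ℝ) (ν : Measure (NetState n)) :
    Measure (NetState n) :=
  ∑ e : Event n,
    ENNReal.ofReal (e.rate q12 q21 lam ls / totalRate n q12 q21 lam ls) • ν.map e.apply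

/-- Law at time `t` of the continuous-time Markov chain with the above rates and initial law `ν`:
the number `k` of ticks up to time `t` is Poisson with parameter `totalRate * t`. -/
noncomputable def law {n : ℕ} (q12 q21 lam ls : ℝ) (ν : Measure (NetState n)) (t : ℝ) :
    Measure (NetState n) :=
  Measure.sum fun k : ℕ =>
    ENNReal.ofReal (Real.exp (-(totalRate n q12 q21 lam ls * t)) *
      (totalRate n q12 q21 lam ls * t) ^ k / (k.factorial : ℝ)) •
      (tick q12 q21 lam ls)^[k] ν

/-- Versions and contents fit together: no packet is newer than the source, packets of the same
version have the same content, and a packet with the source's version has the source's state. -/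
def NetState.Consistent {n : ℕ} (z : NetState n) : Prop :=
  (∀ i, z.version i ≤ z.srcVersion) ∧
  (∀ i j, z.version i = z.version j → z.content i = z.content j) ∧
  (∀ i, z.version i = z.srcVersion → z.content i = z.mode)

/-- Version age `X_i = V₀ - V_i`. -/
def NetState.age {n : ℕ} (z : NetState n) (i : Fin n) : ℕ := z.srcVersion - z.version i

/-- Accuracy `C_i` of node `i`. -/
noncomputable def NetState.acc {n : ℕ} (z : NetState n) (i : Fin n) : ℝ :=
  if z.content i = z.mode then 1 else 0

/-- Average accuracy `C_A` of the nodes in `A`. -/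
noncomputable def NetState.avgAcc {n : ℕ} (A : Finset (Fin n)) (z : NetState n) : ℝ :=
  (∑ i ∈ A, z.acc i) / (A.card : ℝ)

open Classical in
/-- Accuracy `F_A` of the freshest node (the node of least version age) in `A`. In a consistent
state all freshest nodes of `A` have the same content, see `freshAcc_eq`. -/
noncomputable def NetState.freshAcc {n : ℕ} (A : Finset (Fin n)) (z : NetState n) : ℝ :=
  if ∃ l ∈ A, (∀ j ∈ A, z.age l ≤ z.age j) ∧ z.content l = z.mode then 1 else 0

theorem NetState.freshAcc_eq {n : ℕ} {A : Finset (Fin n)} {z : NetState n} (hz : z.Consistent)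
    {l : Fin n} (hl : l ∈ A) (hmin : ∀ j ∈ A, z.age l ≤ z.age j) :
    z.freshAcc A = z.acc l := by
  obtain ⟨h1, h2, -⟩ := hz
  unfold NetState.freshAcc NetState.acc
  have key : (∃ l ∈ A, (∀ j ∈ A, z.age l ≤ z.age j) ∧ z.content l = z.mode) ↔
      z.content l = z.mode := by
    constructor
    · rintro ⟨m, hm, hmm, hc⟩
      have e : z.age l = z.age m := le_antisymm (hmin m hm) (hmm l hl)
      have := h1 l
      have := h1 m
      unfold NetState.age at e
      rw [h2 l m (by omega), hc]
    · exact fun h => ⟨l, hl, hmin, h⟩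
  simp only [key]

/-- `(E[ψ(Z(t)) 1{Q(t) = 1}], E[ψ(Z(t)) 1{Q(t) = 2}])`, for the chain started from `ν`. -/
noncomputable def modeTagged {n : ℕ} (q12 q21 lam ls : ℝ) (ν : Measure (NetState n))
    (ψ : NetState n → ℝ) (t : ℝ) : Fin 2 → ℝ :=
  fun m => ∫ z, (if z.mode = m then ψ z else 0) ∂(law q12 q21 lam ls ν t)

/-- Stationary distribution of the source. -/
noncomputable def sourcePi (q12 q21 : ℝ) : Fin 2 → ℝ :=
  ![q21 / (q12 + q21), q12 / (q12 + q21)]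

/-- Total push rate `α_k` into a set of `k` nodes. -/
noncomputable def alphaRate (n : ℕ) (ls : ℝ) (k : ℕ) : ℝ := k * ls / n

/-- Total gossip rate `β_k` into a set of `k` nodes from outside. -/
noncomputable def betaRate (n : ℕ) (lam : ℝ) (k : ℕ) : ℝ :=
  k * ((n : ℝ) - k) * lam / ((n : ℝ) - 1)

/-- The matrix `W_k` with `α = α_k`, `β = β_k`. -/
def recMatrix (q12 q21 α β : ℝ) : Matrix (Fin 2) (Fin 2) ℝ :=
  !![q12 + α + β, q21; q12, q21 + α + β]

/-- The vector `v_k` with `α = α_k`. -/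
noncomputable def recVec (q12 q21 α : ℝ) : Fin 2 → ℝ :=
  ![q21 * sourcePi q12 q21 1 + α * sourcePi q12 q21 0,
    q12 * sourcePi q12 q21 0 + α * sourcePi q12 q21 1]

/-- The boundary value `f_n` of the recursion. -/
noncomputable def boundaryVec (q12 q21 ls : ℝ) : Fin 2 → ℝ :=
  (1 / ((q12 + q21) * (ls + q12 + q21))) • ![q21 * (ls + q21), q12 * (ls + q12)]

/-- `f_{n-j}` from the backward recursion `W_k f_k = v_k + β_k f_{k+1}`, `k = n - 1, n - 2, …`,
started at `f_n = boundaryVec`. -/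
noncomputable def freshRecAux (n : ℕ) (q12 q21 lam ls : ℝ) : ℕ → Fin 2 → ℝ
  | 0 => boundaryVec q12 q21 ls
  | j + 1 =>
      (recMatrix q12 q21 (alphaRate n ls (n - (j + 1))) (betaRate n lam (n - (j + 1))))⁻¹.mulVec
        (recVec q12 q21 (alphaRate n ls (n - (j + 1))) +
          betaRate n lam (n - (j + 1)) • freshRecAux n q12 q21 lam ls j)

/-- `f_k`, `k ≤ n`, from the backward recursion. -/
noncomputable def freshRec (n : ℕ) (q12 q21 lam ls : ℝ) (k : ℕ) : Fin 2 → ℝ :=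
  freshRecAux n q12 q21 lam ls (n - k)

end GossipNetwork

/-! Superposing all Poisson clocks turns the process into a discrete chain of ticks run at total
rate Λ, so limits along the ticks pass to continuous time by Poisson averaging
(`Admissible.tendsto_integral_law`).

The expectations of `F_A 1{Q = m}` form a hierarchy that is closed upwards in `A`: a flip replaces
`F_A` by `1 - F_A` because contents are binary, a push into `A` sets `F_A` to 1, and a message from
`i` into `A` replaces `F_A` by `F_{A ∪ {i}}` (`NetState.freshAcc_gossip_of_mem`). With `k = |A|`,
one tick acts on the pair of expectations as `I - W_k/Λ` plus a forcing that involves only the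
source and sets `A ∪ {i}` with `i` outside `A`. This matrix contracts the `ℓ¹` norm by a factor at
most `1 - (α_k + β_k)/Λ`, so downward induction on `k` gives convergence, from any consistent
initial law, to the solution of `W_k f_k = v_k + β_k f_{k+1}`. The average accuracy is the case `k =
1`.

As the push rate vanishes, `W_k` stays invertible for `0 < k < n` because `β_k > 0`. Only `W_n`
degenerates, and there `f_n` has a closed form that is continuous at 0 (`continuousAt_freshRec`). -/

namespace GossipNetwork

variable {n : ℕ}

/-! ### Contracting iterations with convergent forcing -/

/-- A nonnegative sequence that contracts up to a vanishing error tends to `0`. -/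
theorem tendsto_zero_of_le_mul_add {ρ : ℝ} (h0 : 0 ≤ ρ) (h1 : ρ < 1) {e δ : ℕ → ℝ}
    (he : ∀ k, 0 ≤ e k) (hδ : Tendsto δ atTop (𝓝 0)) (h : ∀ k, e (k + 1) ≤ ρ * e k + δ k) :
    Tendsto e atTop (𝓝 0) := by
  rw [Metric.tendsto_atTop]
  intro ε hε
  obtain ⟨N, hN⟩ := Metric.tendsto_atTop.1 hδ (ε / 2 * (1 - ρ)) (by nlinarith)
  have key : ∀ j, e (N + j) ≤ ρ ^ j * e N + ε / 2 := by
    intro j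
    induction j with
    | zero => simp; linarith
    | succ j ih =>
      have h2 := hN (N + j) (by omega)
      rw [Real.dist_eq, sub_zero] at h2
      have h3 := (abs_lt.1 h2).2
      have h4 := h (N + j)
      have h5 := mul_le_mul_of_nonneg_left ih h0
      rw [← add_assoc, pow_succ]
      nlinarith
  have hp : Tendsto (fun j => ρ ^ j * e N) atTop (𝓝 0) := by
    simpa using (tendsto_pow_atTop_nhds_zero_of_lt_one h0 h1).mul_const (e N)
  obtain ⟨M, hM⟩ := Metric.tendsto_atTop.1 hp (ε / 2) (by linarith)
  refine ⟨N + M, fun k hk => ?_⟩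
  obtain ⟨j, rfl⟩ := Nat.exists_eq_add_of_le (show N ≤ k by omega)
  have h2 := hM j (by omega)
  rw [Real.dist_eq, sub_zero] at h2 ⊢
  rw [abs_of_nonneg (he _)]
  linarith [key j, (abs_lt.1 h2).2]

/-- An affine iteration in the plane whose linear part contracts the `ℓ¹` norm converges to its
fixed point. -/
theorem tendsto_of_affine_iteration {p r s : ℝ} (hp : 0 ≤ p) (hr : 0 ≤ r) (hs : 0 < s)
    (hps : p + s ≤ 1) (hrs : r + s ≤ 1) {x y d d' : ℕ → ℝ} {X Y D D' : ℝ}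
    (hd : Tendsto d atTop (𝓝 D)) (hd' : Tendsto d' atTop (𝓝 D'))
    (hx : ∀ k, x (k + 1) = x k - (p + s) * x k - r * y k + d k)
    (hy : ∀ k, y (k + 1) = y k - p * x k - (r + s) * y k + d' k)
    (hX : (p + s) * X + r * Y = D) (hY : p * X + (r + s) * Y = D') :
    Tendsto x atTop (𝓝 X) ∧ Tendsto y atTop (𝓝 Y) := by
  have h : Tendsto (fun k => |x k - X| + |y k - Y|) atTop (𝓝 0) := by
    -- Both columns of the linear part have absolute sum `1 - s`: `(1 - p - s) + p` and `r + (1 - r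
    -- - s)`.
    refine tendsto_zero_of_le_mul_add (ρ := 1 - s) (δ := fun k => |d k - D| + |d' k - D'|)
      (by linarith) (by linarith) (fun k => by positivity) ?_ ?_
    · simpa using (hd.sub_const D).abs.add (hd'.sub_const D').abs
    · intro k
      have e1 : x (k + 1) - X = (1 - p - s) * (x k - X) + (-r * (y k - Y)) + (d k - D) := by
        rw [hx, ← hX]; ring
      have e2 : y (k + 1) - Y = (-p * (x k - X)) + (1 - r - s) * (y k - Y) + (d' k - D') := by
        rw [hy, ← hY]; ring
      have b1 := abs_add_three ((1 - p - s) * (x k - X)) (-r * (y k - Y)) (d k - D)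
      have b2 := abs_add_three (-p * (x k - X)) ((1 - r - s) * (y k - Y)) (d' k - D')
      rw [← e1, abs_mul, abs_mul, abs_neg, abs_of_nonneg (by linarith : 0 ≤ 1 - p - s),
        abs_of_nonneg hr] at b1
      rw [← e2, abs_mul, abs_mul, abs_neg, abs_of_nonneg (by linarith : 0 ≤ 1 - r - s),
        abs_of_nonneg hp] at b2
      linarith
  constructor
  · rw [tendsto_iff_norm_sub_tendsto_zero]
    exact squeeze_zero (fun _ => norm_nonneg _)
      (fun k => le_add_of_nonneg_right (abs_nonneg (y k - Y))) h
  · rw [tendsto_iff_norm_sub_tendsto_zero]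
    exact squeeze_zero (fun _ => norm_nonneg _)
      (fun k => le_add_of_nonneg_left (abs_nonneg (x k - X))) h

/-! ### Poisson averaging -/

/-- Poisson weights. -/
noncomputable def poissonWeight (x : ℝ) (k : ℕ) : ℝ :=
  Real.exp (-x) * x ^ k / (k.factorial : ℝ)

theorem poissonWeight_nonneg {x : ℝ} (hx : 0 ≤ x) (k : ℕ) : 0 ≤ poissonWeight x k := by
  unfold poissonWeight; positivity

theorem hasSum_poissonWeight (x : ℝ) : HasSum (poissonWeight x) 1 := by
  have h := (NormedSpace.expSeries_div_hasSum_exp (𝔸 := ℝ) x).mul_left (Real.exp (-x))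
  rw [← Real.exp_eq_exp_ℝ, ← Real.exp_add, neg_add_cancel, Real.exp_zero] at h
  have e : poissonWeight x = fun k => Real.exp (-x) * (x ^ k / (k.factorial : ℝ)) :=
    funext fun k => mul_div_assoc _ _ _
  rwa [e]

theorem tendsto_poissonWeight (k : ℕ) : Tendsto (fun x => poissonWeight x k) atTop (𝓝 0) := by
  have h := (Real.tendsto_pow_mul_exp_neg_atTop_nhds_zero k).div_const (k.factorial : ℝ)
  rw [zero_div] at h
  exact h.congr fun x => by rw [poissonWeight, mul_comm]

/-- Poisson averages of a bounded convergent sequence converge to the same limit. -/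
theorem tendsto_tsum_poissonWeight {u : ℕ → ℝ} {l C : ℝ} (hC : ∀ k, |u k| ≤ C)
    (hu : Tendsto u atTop (𝓝 l)) :
    Tendsto (fun x => ∑' k, poissonWeight x k * u k) atTop (𝓝 l) := by
  rw [Metric.tendsto_nhds]
  intro ε hε
  obtain ⟨N, hN⟩ := Metric.tendsto_atTop.1 hu (ε / 2) (by linarith)
  -- The first `N` terms are only bounded by `C + |l|`, but their total Poisson weight vanishes;
  -- later terms are within `ε / 2` of `l`.
  have hfin : Tendsto (fun x => ∑ k ∈ Finset.range N, poissonWeight x k * (C + |l|)) atTop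
      (𝓝 0) := by
    simpa using tendsto_finsetSum (Finset.range N)
      fun k _ => (tendsto_poissonWeight k).mul_const (C + |l|)
  filter_upwards [eventually_ge_atTop 0, hfin.eventually_lt_const (half_pos hε)] with x hx hlt
  have hs := hasSum_poissonWeight x
  have hw : ∀ k, |u k - l| ≤ ε / 2 + (if k ∈ Finset.range N then C + |l| else 0) := by
    intro k
    split_ifs with hk
    · linarith [abs_sub (u k) l, hC k]
    · have := hN k (by simpa using hk)
      rw [Real.dist_eq] at this
      linarith
  have hsu : Summable fun k => poissonWeight x k * u k := by
    refine Summable.of_norm_bounded (hs.summable.mul_right C) fun k => ?_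
    rw [norm_mul, Real.norm_of_nonneg (poissonWeight_nonneg hx k)]
    exact mul_le_mul_of_nonneg_left (hC k) (poissonWeight_nonneg hx k)
  have h1 : HasSum (fun k => poissonWeight x k * (u k - l))
      (∑' k, poissonWeight x k * u k - l) := by
    simpa [mul_sub] using hsu.hasSum.sub (hs.mul_right l)
  have h2 : HasSum (fun k => poissonWeight x k *
      (ε / 2 + (if k ∈ Finset.range N then C + |l| else 0)))
      (1 * (ε / 2) + ∑ k ∈ Finset.range N, poissonWeight x k * (C + |l|)) := by
    simp only [mul_add _ (ε / 2)]
    refine (hs.mul_right (ε / 2)).add ?_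
    have := hasSum_sum_of_ne_finset_zero (L := SummationFilter.unconditional ℕ) (s := Finset.range N)
      (f := fun k => poissonWeight x k * (if k ∈ Finset.range N then C + |l| else 0))
      fun k hk => by simp [hk]
    rwa [Finset.sum_congr rfl fun k hk => by rw [if_pos hk]] at this
  have hb : ∀ k, ‖poissonWeight x k * (u k - l)‖ ≤ poissonWeight x k *
      (ε / 2 + (if k ∈ Finset.range N then C + |l| else 0)) := fun k => by
    rw [norm_mul, Real.norm_of_nonneg (poissonWeight_nonneg hx k)]
    exact mul_le_mul_of_nonneg_left (hw k) (poissonWeight_nonneg hx k)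
  have h3 := tsum_of_norm_bounded h2 hb
  rw [h1.tsum_eq, Real.norm_eq_abs] at h3
  rw [Real.dist_eq]
  linarith

/-! ### The linear recursion and its continuity in the push rate -/

/-- The determinant factors as `(α + β)(q12 + q21 + α + β)`, so singularity threatens only when `α +
β = 0`, that is, for the full node set without pushes. -/
theorem isUnit_det_recMatrix {q12 q21 α β : ℝ} (h12 : 0 < q12) (h21 : 0 < q21)
    (h : 0 < α + β) : IsUnit (recMatrix q12 q21 α β).det := by
  rw [isUnit_iff_ne_zero, recMatrix, Matrix.det_fin_two_of]
  nlinarith [mul_pos h h12, mul_pos h h21]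

theorem recMatrix_mulVec_eq_iff {q12 q21 α β : ℝ} (h12 : 0 < q12) (h21 : 0 < q21)
    (h : 0 < α + β) (x v : Fin 2 → ℝ) :
    (recMatrix q12 q21 α β).mulVec x = v ↔ x = (recMatrix q12 q21 α β)⁻¹.mulVec v := by
  have hu := isUnit_det_recMatrix h12 h21 h
  constructor
  · rintro rfl
    rw [Matrix.mulVec_mulVec, Matrix.nonsing_inv_mul _ hu, Matrix.one_mulVec]
  · rintro rfl
    rw [Matrix.mulVec_mulVec, Matrix.mul_nonsing_inv _ hu, Matrix.one_mulVec]

theorem alphaRate_pos {n k : ℕ} {ls : ℝ} (hn : 0 < n) (hk : 0 < k) (hls : 0 < ls) :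
    0 < alphaRate n ls k := by
  unfold alphaRate; positivity

theorem betaRate_nonneg {n k : ℕ} {lam : ℝ} (hn : 2 ≤ n) (hlam : 0 ≤ lam) (hk : k ≤ n) :
    0 ≤ betaRate n lam k := by
  have h1 : (2 : ℝ) ≤ n := by exact_mod_cast hn
  have h2 : (k : ℝ) ≤ n := by exact_mod_cast hk
  exact div_nonneg (mul_nonneg (mul_nonneg k.cast_nonneg (by linarith)) hlam) (by linarith)

theorem betaRate_pos {n k : ℕ} {lam : ℝ} (hlam : 0 < lam) (hk : 0 < k) (hkn : k < n) :
    0 < betaRate n lam k := by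
  have h1 : (1 : ℝ) ≤ k := by exact_mod_cast hk
  have h2 : (k : ℝ) < n := by exact_mod_cast hkn
  exact div_pos (mul_pos (mul_pos (by linarith) (by linarith)) hlam) (by linarith)

theorem freshRec_self (n : ℕ) (q12 q21 lam ls : ℝ) :
    freshRec n q12 q21 lam ls n = boundaryVec q12 q21 ls := by
  simp [freshRec, freshRecAux]

theorem freshRec_of_lt {n k : ℕ} (hk : k < n) (q12 q21 lam ls : ℝ) :
    freshRec n q12 q21 lam ls k =
      (recMatrix q12 q21 (alphaRate n ls k) (betaRate n lam k))⁻¹.mulVec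
        (recVec q12 q21 (alphaRate n ls k) +
          betaRate n lam k • freshRec n q12 q21 lam ls (k + 1)) := by
  obtain ⟨j, rfl⟩ := Nat.exists_eq_add_of_lt hk
  have h1 : k + j + 1 - k = j + 1 := by omega
  have h2 : k + j + 1 - (j + 1) = k := by omega
  have h3 : k + j + 1 - (k + 1) = j := by omega
  simp only [freshRec, h1, h3, freshRecAux, h2]

/-- Since `α_n = ls` and `β_n = 0`, this is the recursion at `k = n`; it lets the full node set be
treated like every other set. -/
theorem recMatrix_mulVec_boundaryVec {q12 q21 ls : ℝ} (h12 : 0 < q12) (h21 : 0 < q21)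
    (hls : 0 < ls) :
    (recMatrix q12 q21 ls 0).mulVec (boundaryVec q12 q21 ls) = recVec q12 q21 ls := by
  have h1 : q12 + q21 ≠ 0 := by positivity
  have h2 : ls + q12 + q21 ≠ 0 := by positivity
  ext m
  fin_cases m <;>
  · simp [recMatrix, boundaryVec, recVec, sourcePi, Matrix.mulVec, dotProduct, Fin.sum_univ_two]
    field_simp
    ring

/-- The recursion `W_k f_k = v_k + β_k f_{k+1}`, including `k = n`, where `β_n = 0`. -/
theorem recMatrix_mulVec_freshRec {n k : ℕ} {q12 q21 lam ls : ℝ} (h12 : 0 < q12) (h21 : 0 < q21)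
    (hlam : 0 < lam) (hls : 0 < ls) (hk : 0 < k) (hkn : k ≤ n) :
    (recMatrix q12 q21 (alphaRate n ls k) (betaRate n lam k)).mulVec
        (freshRec n q12 q21 lam ls k) =
      recVec q12 q21 (alphaRate n ls k) +
        betaRate n lam k • freshRec n q12 q21 lam ls (k + 1) := by
  rcases hkn.lt_or_eq with h | rfl
  · rw [recMatrix_mulVec_eq_iff h12 h21
      (add_pos (alphaRate_pos (by omega) hk hls) (betaRate_pos hlam hk h)), freshRec_of_lt h]
  · have hk' : (k : ℝ) ≠ 0 := by positivity
    have ha : alphaRate k ls k = ls := by unfold alphaRate; field_simp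
    have hb : betaRate k lam k = 0 := by simp [betaRate]
    -- The value of `freshRec` at `n + 1` is meaningless, but its coefficient is `β_n = 0`.
    rw [ha, hb, freshRec_self, recMatrix_mulVec_boundaryVec h12 h21 hls, zero_smul, add_zero]

/-- Downward induction from the closed form at `n`, whose denominator at `ls = 0` is `(q12 + q21)²`;
each further step applies an inverse matrix that is continuous at 0. -/
theorem continuousAt_freshRec {n : ℕ} {q12 q21 lam : ℝ} (h12 : 0 < q12) (h21 : 0 < q21)
    (hlam : 0 < lam) {k : ℕ} (hk : 0 < k) (hkn : k ≤ n) :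
    ContinuousAt (fun ls => freshRec n q12 q21 lam ls k) 0 := by
  induction hkn using Nat.decreasingInduction with
  | self =>
    simp only [freshRec_self, boundaryVec]
    have hne : (q12 + q21) * (0 + q12 + q21) ≠ 0 := by positivity
    have hden : ContinuousAt (fun ls => (q12 + q21) * (ls + q12 + q21)) 0 := by fun_prop
    refine ContinuousAt.smul (continuousAt_const.div hden hne) ?_
    refine Continuous.continuousAt (continuous_pi fun m => ?_)
    fin_cases m <;> simp <;> fun_prop
  | of_succ k hkn ih =>
    have ih := ih (by omega)
    simp only [freshRec_of_lt hkn]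
    have ha : Continuous fun ls => alphaRate n ls k := by unfold alphaRate; fun_prop
    have hW : Continuous fun ls => recMatrix q12 q21 (alphaRate n ls k) (betaRate n lam k) := by
      refine continuous_matrix fun i j => ?_
      fin_cases i <;> fin_cases j <;> simp [recMatrix] <;> fun_prop
    have hv : Continuous fun ls => recVec q12 q21 (alphaRate n ls k) := by
      refine continuous_pi fun m => ?_
      fin_cases m <;> simp [recVec] <;> fun_prop
    -- At `ls = 0` the rate `α_k` is gone, and `β_k > 0` alone keeps the matrix invertible.
    have hdet := isUnit_det_recMatrix (α := alphaRate n 0 k) (β := betaRate n lam k) h12 h21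
      (by have := betaRate_pos hlam hk hkn; simpa [alphaRate] using this)
    have hinv : ContinuousAt
        (fun ls => (recMatrix q12 q21 (alphaRate n ls k) (betaRate n lam k))⁻¹) 0 := by
      simp only [Matrix.inv_def, Ring.inverse_eq_inv']
      exact (hW.matrix_det.continuousAt.inv₀ hdet.ne_zero).smul hW.matrix_adjugate.continuousAt
    exact ContinuousAt.comp₂ (f := fun p : Matrix (Fin 2) (Fin 2) ℝ × (Fin 2 → ℝ) => p.1.mulVec p.2)
      (continuous_fst.matrix_mulVec continuous_snd).continuousAt hinv
      (hv.continuousAt.add (ContinuousAt.fun_const_smul ih _))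

/-! ### Effect of single events on the freshest packet -/

/-- After a flip the source is strictly newer than every packet, so the third clause holds
vacuously. After a push, the old third clause makes the new packet agree with any packet of the same
version. -/
theorem NetState.Consistent.apply {z : NetState n} (hz : z.Consistent) (e : Event n) :
    (e.apply z).Consistent := by
  obtain ⟨h1, h2, h3⟩ := hz
  cases e with
  | flip12 =>
    simp only [Event.apply]
    split_ifs with h
    · exact ⟨fun i => (h1 i).trans (Nat.le_succ _), h2,
        fun i hi => by have := h1 i; simp only at hi; omega⟩
    · exact ⟨h1, h2, h3⟩
  | flip21 =>
    simp only [Event.apply]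
    split_ifs with h
    · exact ⟨fun i => (h1 i).trans (Nat.le_succ _), h2,
        fun i hi => by have := h1 i; simp only at hi; omega⟩
    · exact ⟨h1, h2, h3⟩
  | push j =>
    refine ⟨fun i => ?_, fun i k => ?_, fun i => ?_⟩ <;> simp only [Event.apply, Function.update_apply]
    · split_ifs <;> simp [h1]
    · split_ifs with ha hb hb
      · simp
      · exact fun h => (h3 k h.symm).symm
      · exact h3 i
      · exact h2 i k
    · split_ifs
      · simp
      · exact h3 i
  | gossip i j =>
    simp only [Event.apply]
    split_ifs with h
    · refine ⟨fun l => ?_, fun l k => ?_, fun l => ?_⟩ <;> simp only [Function.update_apply]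
      · split_ifs <;> exact h1 _
      · split_ifs
        · simp
        · exact h2 i k
        · exact h2 l i
        · exact h2 l k
      · split_ifs <;> exact h3 _
    · exact ⟨h1, h2, h3⟩

/-- `F_A 1{Q = m}`. -/
noncomputable def freshTagged (A : Finset (Fin n)) (m : Fin 2) (z : NetState n) : ℝ :=
  if z.mode = m then z.freshAcc A else 0

/-- `1{Q = m}`. -/
noncomputable def modeInd (n : ℕ) (m : Fin 2) (z : NetState n) : ℝ := if z.mode = m then 1 else 0

theorem NetState.freshAcc_eq_of_max {A : Finset (Fin n)} {z : NetState n} (hz : z.Consistent)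
    {l : Fin n} (hl : l ∈ A) (hmax : ∀ j ∈ A, z.version j ≤ z.version l) :
    z.freshAcc A = z.acc l :=
  NetState.freshAcc_eq hz hl fun j hj => Nat.sub_le_sub_left (hmax j hj) _

theorem NetState.exists_max_version (z : NetState n) {A : Finset (Fin n)} (hA : A.Nonempty) :
    ∃ l ∈ A, (∀ j ∈ A, z.version j ≤ z.version l) :=
  A.exists_max_image z.version hA

theorem NetState.freshAcc_singleton (i : Fin n) (z : NetState n) : z.freshAcc {i} = z.acc i := by
  simp [NetState.freshAcc, NetState.acc]

theorem NetState.acc_flip {z w : NetState n} (hc : w.content = z.content)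
    (hm : w.mode ≠ z.mode) (i : Fin n) : w.acc i = 1 - z.acc i := by
  have : w.content i = z.content i := congrFun hc i
  unfold NetState.acc
  rw [this]
  generalize z.content i = a at *
  generalize z.mode = b at *
  generalize w.mode = c at *
  fin_cases a <;> fin_cases b <;> fin_cases c <;> simp_all

theorem NetState.freshAcc_flip {A : Finset (Fin n)} (hA : A.Nonempty) {z w : NetState n}
    (hz : z.Consistent) (hw : w.Consistent) (hv : w.version = z.version)
    (hc : w.content = z.content) (hm : w.mode ≠ z.mode) : w.freshAcc A = 1 - z.freshAcc A := by
  obtain ⟨l, hl, hmax⟩ := z.exists_max_version hA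
  rw [freshAcc_eq_of_max hz hl hmax, freshAcc_eq_of_max hw hl (by rwa [hv]), acc_flip hc hm]

/-- All the mass in mode `0` moves to mode `1`, arriving as `1 - F_A`. -/
theorem freshTagged_flip12 {A : Finset (Fin n)} (hA : A.Nonempty) {z : NetState n}
    (hz : z.Consistent) (m : Fin 2) :
    freshTagged A m (Event.flip12.apply z) = freshTagged A m z +
      ![-freshTagged A 0 z, modeInd n 0 z - freshTagged A 0 z] m := by
  have hw := hz.apply .flip12
  by_cases h : z.mode = 0
  · simp only [Event.apply, if_pos h] at hw ⊢
    have hf := NetState.freshAcc_flip hA hz hw rfl rfl (by simp [h])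
    fin_cases m <;> simp [freshTagged, modeInd, h, hf]
  · simp only [Event.apply, if_neg h]
    fin_cases m <;> simp [freshTagged, modeInd, h]

theorem freshTagged_flip21 {A : Finset (Fin n)} (hA : A.Nonempty) {z : NetState n}
    (hz : z.Consistent) (m : Fin 2) :
    freshTagged A m (Event.flip21.apply z) = freshTagged A m z +
      ![modeInd n 1 z - freshTagged A 1 z, -freshTagged A 1 z] m := by
  have hw := hz.apply .flip21
  by_cases h : z.mode = 1
  · simp only [Event.apply, if_pos h] at hw ⊢
    have hf := NetState.freshAcc_flip hA hz hw rfl rfl (by simp [h])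
    fin_cases m <;> simp [freshTagged, modeInd, h, hf]
  · simp only [Event.apply, if_neg h]
    fin_cases m <;> simp [freshTagged, modeInd, h]

/-- A pushed packet is at least as new as all others and correct, so `F_A` becomes 1 if the receiver
lies in `A`. -/
theorem freshTagged_push {A : Finset (Fin n)} {z : NetState n} (hz : z.Consistent) (j : Fin n)
    (m : Fin 2) :
    freshTagged A m ((Event.push j).apply z) = freshTagged A m z +
      if j ∈ A then modeInd n m z - freshTagged A m z else 0 := by
  have hw := hz.apply (.push j)
  have hmode : ((Event.push j).apply z).mode = z.mode := rfl
  split_ifs with hj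
  · have hf : ((Event.push j).apply z).freshAcc A = 1 := by
      rw [NetState.freshAcc_eq_of_max hw hj fun i _ => ?_]
      · simp [NetState.acc, Event.apply]
      · refine (hw.1 i).trans_eq ?_
        simp [Event.apply]
    simp only [freshTagged, modeInd, hmode, hf]
    split_ifs <;> ring
  · have hf : ((Event.push j).apply z).freshAcc A = z.freshAcc A := by
      have hv : ∀ i ∈ A, ((Event.push j).apply z).age i = z.age i ∧
          ((Event.push j).apply z).content i = z.content i := fun i hi => by
        have : i ≠ j := fun h => hj (h ▸ hi)
        simp [Event.apply, NetState.age, this]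
      obtain rfl | hA := A.eq_empty_or_nonempty
      · simp [NetState.freshAcc]
      obtain ⟨l, hl, hmax⟩ := A.exists_min_image z.age hA
      rw [NetState.freshAcc_eq hz hl hmax, NetState.freshAcc_eq hw hl fun i hi => by
        rw [(hv l hl).1, (hv i hi).1]; exact hmax i hi]
      simp only [NetState.acc, (hv l hl).2, hmode]
    simp only [freshTagged, hmode, hf, add_zero]

/-- Newest-wins adoption makes the largest version in `A` after the message equal to the largest one
in `A ∪ {i}` before it. This identity closes the hierarchy. -/
theorem NetState.freshAcc_gossip_of_mem {A : Finset (Fin n)} {z : NetState n} (hz : z.Consistent)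
    {i j : Fin n} (hj : j ∈ A) :
    ((Event.gossip i j).apply z).freshAcc A = z.freshAcc (insert i A) := by
  have hw := hz.apply (.gossip i j)
  obtain ⟨l, hl, hmax⟩ := z.exists_max_version ⟨j, hj⟩
  by_cases hij : z.version j < z.version i
  · simp only [Event.apply, if_pos hij] at hw ⊢
    by_cases hli : z.version l < z.version i
    · rw [freshAcc_eq_of_max hz (Finset.mem_insert_self i A) fun k hk => ?_,
        freshAcc_eq_of_max hw hj fun k hk => ?_]
      · simp [acc]
      · simp only [Function.update_apply, if_true]
        have := hmax k hk
        split_ifs <;> omega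
      · rcases Finset.mem_insert.1 hk with rfl | hk
        · exact le_rfl
        · exact (hmax k hk).trans hli.le
    · have hlj : l ≠ j := by rintro rfl; exact hli hij
      rw [freshAcc_eq_of_max hz (Finset.mem_insert_of_mem hl) fun k hk => ?_,
        freshAcc_eq_of_max hw hl fun k hk => ?_]
      · simp [acc, hlj]
      · simp only [Function.update_apply, if_neg hlj]
        have := hmax k hk
        split_ifs <;> omega
      · rcases Finset.mem_insert.1 hk with rfl | hk
        · omega
        · exact hmax k hk
  · simp only [Event.apply, if_neg hij]
    rw [freshAcc_eq_of_max hz hl hmax,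
      freshAcc_eq_of_max hz (Finset.mem_insert_of_mem hl) fun k hk => ?_]
    rcases Finset.mem_insert.1 hk with rfl | hk
    · have := hmax j hj; omega
    · exact hmax k hk

theorem NetState.freshAcc_gossip_of_notMem {A : Finset (Fin n)} (hA : A.Nonempty) {z : NetState n}
    (hz : z.Consistent) {i j : Fin n} (hj : j ∉ A) :
    ((Event.gossip i j).apply z).freshAcc A = z.freshAcc A := by
  have hw := hz.apply (.gossip i j)
  by_cases hij : z.version j < z.version i
  · simp only [Event.apply, if_pos hij] at hw ⊢
    obtain ⟨l, hl, hmax⟩ := z.exists_max_version hA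
    have hne : ∀ k ∈ A, k ≠ j := fun k hk h => hj (h ▸ hk)
    rw [freshAcc_eq_of_max hz hl hmax, freshAcc_eq_of_max hw hl fun k hk => ?_]
    · simp [acc, hne l hl]
    · simpa [hne l hl, hne k hk] using hmax k hk
  · simp only [Event.apply, if_neg hij]

theorem freshTagged_gossip {A : Finset (Fin n)} (hA : A.Nonempty) {z : NetState n}
    (hz : z.Consistent) (i j : Fin n) (m : Fin 2) :
    freshTagged A m ((Event.gossip i j).apply z) = freshTagged A m z +
      if j ∈ A then freshTagged (insert i A) m z - freshTagged A m z else 0 := by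
  have hmode : ((Event.gossip i j).apply z).mode = z.mode := by
    simp only [Event.apply]; split_ifs <;> rfl
  split_ifs with hj
  · simp only [freshTagged, hmode, NetState.freshAcc_gossip_of_mem hz hj]
    ring
  · simp only [freshTagged, hmode, NetState.freshAcc_gossip_of_notMem hA hz hj, add_zero]

/-! ### The generator -/

/-- Sums over all events. -/
theorem sum_event (g : Event n → ℝ) :
    ∑ e, g e = g .flip12 + g .flip21 + ∑ j, g (.push j) + ∑ i, ∑ j, g (.gossip i j) := by
  let φ : (Unit ⊕ Unit) ⊕ (Fin n ⊕ (Fin n × Fin n)) ≃ Event n :=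
    { toFun := Sum.elim (Sum.elim (fun _ => .flip12) fun _ => .flip21)
        (Sum.elim (fun j => .push j) fun p => .gossip p.1 p.2)
      invFun := fun e => match e with
        | .flip12 => .inl (.inl ())
        | .flip21 => .inl (.inr ())
        | .push j => .inr (.inl j)
        | .gossip i j => .inr (.inr (i, j))
      left_inv := by rintro ((_ | _) | (_ | _)) <;> rfl
      right_inv := by rintro (_ | _ | _ | _) <;> rfl }
  rw [← φ.sum_comp]
  simp only [Fintype.sum_sum_type, Fintype.sum_prod_type]
  simp [φ, add_assoc]

/-- The action of the generator on `F_A 1{Q = m}`. -/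
theorem sum_rate_mul_freshTagged {A : Finset (Fin n)} (hA : A.Nonempty)
    {z : NetState n} (hz : z.Consistent) (q12 q21 lam ls : ℝ) (m : Fin 2) :
    ∑ e : Event n, e.rate q12 q21 lam ls * freshTagged A m (e.apply z) =
      totalRate n q12 q21 lam ls * freshTagged A m z -
        (recMatrix q12 q21 (alphaRate n ls A.card) (betaRate n lam A.card)).mulVec
          (fun m => freshTagged A m z) m +
        (![q21 * modeInd n 1 z, q12 * modeInd n 0 z] m + alphaRate n ls A.card * modeInd n m z) +
        A.card * lam / ((n : ℝ) - 1) * ∑ i ∈ Aᶜ, freshTagged (insert i A) m z := by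
  have hpush : ∑ j : Fin n, ls / n * (if j ∈ A then modeInd n m z - freshTagged A m z else 0) =
      alphaRate n ls A.card * (modeInd n m z - freshTagged A m z) := by
    simp only [mul_ite, mul_zero, Finset.sum_ite_mem, Finset.univ_inter, Finset.sum_const,
      nsmul_eq_mul, alphaRate]
    ring
  have hgossip : ∑ i : Fin n, ∑ j : Fin n, (if i = j then 0 else lam / ((n : ℝ) - 1)) *
      (if j ∈ A then freshTagged (insert i A) m z - freshTagged A m z else 0) =
      A.card * lam / ((n : ℝ) - 1) * ∑ i ∈ Aᶜ, freshTagged (insert i A) m z -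
        betaRate n lam A.card * freshTagged A m z := by
    -- A sender inside `A` contributes nothing as `insert i A = A`; a sender outside reaches each of
    -- the `|A|` receivers at rate `lam / (n - 1)`.
    have h1 : ∀ i : Fin n, ∑ j : Fin n, (if i = j then 0 else lam / ((n : ℝ) - 1)) *
        (if j ∈ A then freshTagged (insert i A) m z - freshTagged A m z else 0) =
        if i ∈ Aᶜ then A.card * lam / ((n : ℝ) - 1) *
          (freshTagged (insert i A) m z - freshTagged A m z) else 0 := by
      intro i
      by_cases hi : i ∈ A
      · simp [hi]
      · have : ∀ j : Fin n, (if i = j then 0 else lam / ((n : ℝ) - 1)) *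
            (if j ∈ A then freshTagged (insert i A) m z - freshTagged A m z else 0) =
            if j ∈ A then lam / ((n : ℝ) - 1) *
              (freshTagged (insert i A) m z - freshTagged A m z) else 0 := by
          intro j
          by_cases hj : j ∈ A
          · have : i ≠ j := fun h => hi (h ▸ hj)
            simp [hj, this]
          · simp [hj]
        simp only [this, Finset.mem_compl, hi, not_false_eq_true, if_true, Finset.sum_ite_mem,
          Finset.univ_inter, Finset.sum_const, nsmul_eq_mul]
        ring
    simp only [h1, Finset.sum_ite_mem, Finset.univ_inter, ← Finset.mul_sum,
      Finset.sum_sub_distrib, Finset.sum_const, nsmul_eq_mul, betaRate, Finset.card_compl,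
      Fintype.card_fin, Nat.cast_sub (card_finset_fin_le A)]
    ring
  have htot : totalRate n q12 q21 lam ls * freshTagged A m z =
      ∑ e : Event n, e.rate q12 q21 lam ls * freshTagged A m z := by
    rw [totalRate, Finset.sum_mul]
  rw [htot, sum_event, sum_event]
  simp only [Event.rate, freshTagged_flip12 hA hz, freshTagged_flip21 hA hz,
    freshTagged_push hz, freshTagged_gossip hA hz, mul_add, Finset.sum_add_distrib, hpush, hgossip]
  fin_cases m <;>
  · simp [recMatrix, Matrix.mulVec, dotProduct, Fin.sum_univ_two]
    ring

/-- The action of the generator on `1{Q = m}`. -/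
theorem sum_rate_mul_modeInd (z : NetState n) (q12 q21 lam ls : ℝ) (m : Fin 2) :
    ∑ e : Event n, e.rate q12 q21 lam ls * modeInd n m (e.apply z) =
      totalRate n q12 q21 lam ls * modeInd n m z +
        ![q21 - (q12 + q21) * modeInd n 0 z, q12 - (q12 + q21) * modeInd n 1 z] m := by
  have htot : totalRate n q12 q21 lam ls * modeInd n m z =
      ∑ e : Event n, e.rate q12 q21 lam ls * modeInd n m z := by
    rw [totalRate, Finset.sum_mul]
  have hp : ∀ j, modeInd n m ((Event.push j).apply z) = modeInd n m z := fun j => rfl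
  have hg : ∀ i j, modeInd n m ((Event.gossip i j).apply z) = modeInd n m z := fun i j => by
    simp only [modeInd, Event.apply]; split_ifs <;> rfl
  rw [htot, sum_event, sum_event]
  simp only [hp, hg, Event.rate]
  have hz : z.mode = 0 ∨ z.mode = 1 := by
    generalize z.mode = a; fin_cases a <;> simp
  rcases hz with h | h <;> fin_cases m <;> simp [modeInd, Event.apply, h] <;> ring

/-! ### The tick chain and its Poisson mixture -/

instance : DiscreteMeasurableSpace (NetState n) := ⟨fun _ => trivial⟩

theorem totalRate_eq (hn : 2 ≤ n) (q12 q21 lam ls : ℝ) :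
    totalRate n q12 q21 lam ls = q12 + q21 + ls + n * lam := by
  have h1 : (2 : ℝ) ≤ n := by exact_mod_cast hn
  have h2 : (n : ℝ) - 1 ≠ 0 := by linarith
  have h3 : (n : ℝ) ≠ 0 := by linarith
  have h4 : ∀ i : Fin n, ∑ j : Fin n, (if i = j then 0 else lam / ((n : ℝ) - 1)) = lam := by
    intro i
    have : ∀ j : Fin n, (if i = j then 0 else lam / ((n : ℝ) - 1)) =
        lam / ((n : ℝ) - 1) - if i = j then lam / ((n : ℝ) - 1) else 0 := fun j => by
      split_ifs <;> ring
    simp only [this, Finset.sum_sub_distrib, Finset.sum_ite_eq, Finset.mem_univ, if_true,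
      Finset.sum_const, Finset.card_univ, Fintype.card_fin, nsmul_eq_mul]
    field_simp
  rw [totalRate, sum_event]
  simp only [Event.rate, h4, Finset.sum_const, Finset.card_univ, Fintype.card_fin, nsmul_eq_mul]
  field_simp

/-- Standing assumptions on the rates. -/
structure Admissible (n : ℕ) (q12 q21 lam ls : ℝ) : Prop where
  two_le : 2 ≤ n
  q12_pos : 0 < q12
  q21_pos : 0 < q21
  lam_pos : 0 < lam
  ls_pos : 0 < ls

variable {q12 q21 lam ls : ℝ}

namespace Admissible

theorem totalRate_pos (h : Admissible n q12 q21 lam ls) : 0 < totalRate n q12 q21 lam ls := by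
  obtain ⟨h1, h2, h3, h4, h5⟩ := h
  rw [totalRate_eq h1]
  positivity

theorem rate_nonneg (h : Admissible n q12 q21 lam ls) (e : Event n) :
    0 ≤ e.rate q12 q21 lam ls := by
  obtain ⟨h1, h2, h3, h4, h5⟩ := h
  have h6 : (2 : ℝ) ≤ n := by exact_mod_cast h1
  cases e with
  | flip12 => exact h2.le
  | flip21 => exact h3.le
  | push j => exact div_nonneg h5.le (by linarith)
  | gossip i j =>
    simp only [Event.rate]
    split_ifs
    · exact le_rfl
    · exact div_nonneg h4.le (by linarith)

/-- This makes the diagonal of `I - W_k/Λ` nonnegative, as the `ℓ¹` contraction needs. -/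
theorem alphaRate_add_betaRate_le (h : Admissible n q12 q21 lam ls) {k : ℕ} (hk : 0 < k)
    (hkn : k ≤ n) :
    q12 + q21 + (alphaRate n ls k + betaRate n lam k) ≤ totalRate n q12 q21 lam ls := by
  obtain ⟨h1, h2, h3, h4, h5⟩ := h
  have h6 : (2 : ℝ) ≤ n := by exact_mod_cast h1
  have h7 : (1 : ℝ) ≤ k := by exact_mod_cast hk
  have h8 : (k : ℝ) ≤ n := by exact_mod_cast hkn
  have ha : alphaRate n ls k ≤ ls := by
    rw [alphaRate, div_le_iff₀ (by linarith), mul_comm]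
    gcongr
  have hb : betaRate n lam k ≤ n * lam := by
    rw [betaRate, div_le_iff₀ (by linarith)]
    have : (k : ℝ) * (n - k) ≤ n * (n - 1) := by
      apply mul_le_mul <;> linarith
    nlinarith
  rw [totalRate_eq h1]
  linarith

theorem sum_weight (h : Admissible n q12 q21 lam ls) :
    ∑ e : Event n, ENNReal.ofReal (e.rate q12 q21 lam ls / totalRate n q12 q21 lam ls) = 1 := by
  rw [← ENNReal.ofReal_sum_of_nonneg fun e _ => div_nonneg (h.rate_nonneg e) h.totalRate_pos.le,
    ← Finset.sum_div]
  change ENNReal.ofReal (totalRate n q12 q21 lam ls / _) = 1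
  rw [div_self h.totalRate_pos.ne', ENNReal.ofReal_one]

theorem isProbabilityMeasure_tick (h : Admissible n q12 q21 lam ls) (ν : Measure (NetState n))
    [IsProbabilityMeasure ν] : IsProbabilityMeasure (tick q12 q21 lam ls ν) := by
  constructor
  have h1 : ∀ e : Event n, (ν.map e.apply) Set.univ = 1 := fun e => by
    rw [Measure.map_apply Measurable.of_discrete MeasurableSet.univ, Set.preimage_univ,
      measure_univ]
  simp only [tick, Measure.coe_finsetSum, Finset.sum_apply, Measure.smul_apply, h1, smul_eq_mul,
    mul_one, h.sum_weight]

theorem isProbabilityMeasure_tick_iterate (h : Admissible n q12 q21 lam ls)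
    (ν : Measure (NetState n)) [IsProbabilityMeasure ν] (k : ℕ) :
    IsProbabilityMeasure ((tick q12 q21 lam ls)^[k] ν) := by
  induction k with
  | zero => simpa
  | succ k ih =>
    rw [Function.iterate_succ_apply']
    exact h.isProbabilityMeasure_tick _

theorem isProbabilityMeasure_law (h : Admissible n q12 q21 lam ls) (ν : Measure (NetState n))
    [IsProbabilityMeasure ν] {t : ℝ} (ht : 0 ≤ t) :
    IsProbabilityMeasure (law q12 q21 lam ls ν t) := by
  constructor
  have hx := mul_nonneg h.totalRate_pos.le ht
  have h1 : ∀ k, ((tick q12 q21 lam ls)^[k] ν) Set.univ = 1 := fun k =>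
    (h.isProbabilityMeasure_tick_iterate ν k).measure_univ
  rw [law, Measure.sum_apply _ MeasurableSet.univ]
  simp only [Measure.smul_apply, h1, smul_eq_mul, mul_one]
  have hs := hasSum_poissonWeight (totalRate n q12 q21 lam ls * t)
  change ∑' k, ENNReal.ofReal (poissonWeight (totalRate n q12 q21 lam ls * t) k) = 1
  rw [← ENNReal.ofReal_tsum_of_nonneg (poissonWeight_nonneg hx) hs.summable, hs.tsum_eq,
    ENNReal.ofReal_one]

end Admissible

theorem integrable_of_abs_le {ν : Measure (NetState n)} [IsFiniteMeasure ν] {ψ : NetState n → ℝ}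
    {C : ℝ} (hψ : ∀ z, |ψ z| ≤ C) : Integrable ψ ν :=
  Integrable.of_bound Measurable.of_discrete.aestronglyMeasurable C (.of_forall hψ)

theorem ae_consistent_tick {ν : Measure (NetState n)} (hν : ∀ᵐ z ∂ν, z.Consistent) :
    ∀ᵐ z ∂(tick q12 q21 lam ls ν), z.Consistent := by
  rw [ae_iff, tick]
  simp only [Measure.coe_finsetSum, Finset.sum_apply, Measure.smul_apply, smul_eq_mul]
  refine Finset.sum_eq_zero fun e _ => ?_
  rw [Measure.map_apply Measurable.of_discrete MeasurableSet.of_discrete]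
  refine mul_eq_zero_of_right _ (measure_mono_null ?_ (ae_iff.1 hν))
  exact fun z hz hc => hz (hc.apply e)

theorem ae_consistent_tick_iterate {ν : Measure (NetState n)} (hν : ∀ᵐ z ∂ν, z.Consistent)
    (k : ℕ) : ∀ᵐ z ∂((tick q12 q21 lam ls)^[k] ν), z.Consistent := by
  induction k with
  | zero => simpa
  | succ k ih =>
    rw [Function.iterate_succ_apply']
    exact ae_consistent_tick ih

/-- Expectations after one tick, through the generator. -/
theorem Admissible.integral_tick (h : Admissible n q12 q21 lam ls) {ν : Measure (NetState n)}
    [IsProbabilityMeasure ν] {ψ : NetState n → ℝ} {C : ℝ} (hψ : ∀ z, |ψ z| ≤ C) :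
    ∫ z, ψ z ∂(tick q12 q21 lam ls ν) =
      (∫ z, ∑ e : Event n, e.rate q12 q21 lam ls * ψ (e.apply z) ∂ν) /
        totalRate n q12 q21 lam ls := by
  have hi : ∀ e : Event n, Integrable (fun z => ψ (e.apply z)) ν := fun e =>
    integrable_of_abs_le fun z => hψ _
  rw [tick, integral_finsetSum_measure, integral_finsetSum, Finset.sum_div]
  · refine Finset.sum_congr rfl fun e _ => ?_
    rw [integral_smul_measure, integral_map Measurable.of_discrete.aemeasurable
      Measurable.of_discrete.aestronglyMeasurable, integral_const_mul, ENNReal.toReal_ofReal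
        (div_nonneg (h.rate_nonneg e) h.totalRate_pos.le), smul_eq_mul]
    ring
  · exact fun e _ => (hi e).const_mul _
  · intro e _
    refine Integrable.smul_measure ?_ ENNReal.ofReal_ne_top
    have := Measure.isProbabilityMeasure_map (μ := ν) (f := e.apply)
      Measurable.of_discrete.aemeasurable
    exact integrable_of_abs_le hψ

/-- Limits along the ticks carry over to limits in continuous time. -/
theorem Admissible.tendsto_integral_law (h : Admissible n q12 q21 lam ls)
    {ν : Measure (NetState n)} [IsProbabilityMeasure ν] {ψ : NetState n → ℝ} {C l : ℝ}
    (hψ : ∀ z, |ψ z| ≤ C)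
    (hl : Tendsto (fun k => ∫ z, ψ z ∂((tick q12 q21 lam ls)^[k] ν)) atTop (𝓝 l)) :
    Tendsto (fun t => ∫ z, ψ z ∂(law q12 q21 lam ls ν t)) atTop (𝓝 l) := by
  have hb : ∀ k, |∫ z, ψ z ∂((tick q12 q21 lam ls)^[k] ν)| ≤ C := fun k => by
    have := h.isProbabilityMeasure_tick_iterate ν k
    have hψ' : ∀ᵐ z ∂((tick q12 q21 lam ls)^[k] ν), ‖ψ z‖ ≤ C := .of_forall hψ
    simpa using norm_integral_le_of_norm_le_const hψ'
  -- The Poisson parameter `totalRate * t` tends to infinity; the series formula is needed only for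
  -- `t ≥ 0`, where the weights are nonnegative.
  refine ((tendsto_tsum_poissonWeight hb hl).comp
    (tendsto_id.const_mul_atTop h.totalRate_pos)).congr' ?_
  filter_upwards [eventually_ge_atTop 0] with t ht
  have hx := mul_nonneg h.totalRate_pos.le ht
  have := h.isProbabilityMeasure_law ν ht
  have hi : Integrable ψ (law q12 q21 lam ls ν t) := integrable_of_abs_le hψ
  unfold law at hi ⊢
  rw [integral_sum_measure hi]
  refine tsum_congr fun k => ?_
  rw [integral_smul_measure, smul_eq_mul]
  congr 1
  exact (ENNReal.toReal_ofReal (poissonWeight_nonneg hx k)).symm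

/-! ### Evolution and limits of expectations along ticks -/

theorem NetState.abs_freshAcc_le (A : Finset (Fin n)) (z : NetState n) : |z.freshAcc A| ≤ 1 := by
  unfold NetState.freshAcc
  split_ifs <;> simp

theorem abs_freshTagged_le (A : Finset (Fin n)) (m : Fin 2) (z : NetState n) :
    |freshTagged A m z| ≤ 1 := by
  unfold freshTagged
  split_ifs
  · exact z.abs_freshAcc_le A
  · simp

theorem abs_modeInd_le (m : Fin 2) (z : NetState n) : |modeInd n m z| ≤ 1 := by
  unfold modeInd
  split_ifs <;> simp

theorem Admissible.integral_modeInd_tick (h : Admissible n q12 q21 lam ls)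
    {ν : Measure (NetState n)} [IsProbabilityMeasure ν] (m : Fin 2) :
    ∫ z, modeInd n m z ∂(tick q12 q21 lam ls ν) =
      ∫ z, modeInd n m z ∂ν + (![q21, q12] m - (q12 + q21) * ∫ z, modeInd n m z ∂ν) /
        totalRate n q12 q21 lam ls := by
  have hi : Integrable (modeInd n m) ν := integrable_of_abs_le (abs_modeInd_le m)
  have e : ∀ z, ∑ e : Event n, e.rate q12 q21 lam ls * modeInd n m (e.apply z) =
      (totalRate n q12 q21 lam ls - (q12 + q21)) * modeInd n m z + ![q21, q12] m := fun z => by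
    rw [sum_rate_mul_modeInd]
    fin_cases m <;> simp <;> ring
  have hne := h.totalRate_pos.ne'
  rw [h.integral_tick (abs_modeInd_le m)]
  simp only [e]
  rw [integral_add (hi.const_mul _) (integrable_const _), integral_const_mul, integral_const]
  simp only [probReal_univ, one_smul]
  field_simp
  ring

/-- The deviation from `sourcePi` is multiplied by exactly `1 - (q12 + q21)/Λ` at each tick. -/
theorem Admissible.tendsto_integral_modeInd (h : Admissible n q12 q21 lam ls)
    {ν : Measure (NetState n)} [IsProbabilityMeasure ν] (m : Fin 2) :
    Tendsto (fun k => ∫ z, modeInd n m z ∂((tick q12 q21 lam ls)^[k] ν)) atTop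
      (𝓝 (sourcePi q12 q21 m)) := by
  have hpos := h.totalRate_pos
  have hq : 0 < q12 + q21 := add_pos h.q12_pos h.q21_pos
  have hle : q12 + q21 ≤ totalRate n q12 q21 lam ls := by
    rw [totalRate_eq h.two_le]
    have := h.ls_pos
    have := mul_nonneg n.cast_nonneg h.lam_pos.le
    linarith
  have hpi : ![q21, q12] m = (q12 + q21) * sourcePi q12 q21 m := by
    fin_cases m <;> simp [sourcePi] <;> field_simp
  rw [tendsto_iff_norm_sub_tendsto_zero]
  refine tendsto_zero_of_le_mul_add (ρ := 1 - (q12 + q21) / totalRate n q12 q21 lam ls)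
    (δ := fun _ => 0) ?_ ?_ (fun _ => norm_nonneg _) tendsto_const_nhds fun k => ?_
  · rw [sub_nonneg, div_le_one hpos]; exact hle
  · linarith [div_pos hq hpos]
  · have := h.isProbabilityMeasure_tick_iterate ν k
    rw [Function.iterate_succ_apply', h.integral_modeInd_tick, hpi, add_zero,
      ← Real.norm_of_nonneg (show 0 ≤ 1 - (q12 + q21) / totalRate n q12 q21 lam ls by
        rw [sub_nonneg, div_le_one hpos]; exact hle), ← norm_mul]
    apply le_of_eq
    congr 1
    ring

/-- One tick of the expectations of `F_A 1{Q = m}`. -/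
theorem Admissible.integral_freshTagged_tick (h : Admissible n q12 q21 lam ls)
    {ν : Measure (NetState n)} [IsProbabilityMeasure ν] (hν : ∀ᵐ z ∂ν, z.Consistent)
    {A : Finset (Fin n)} (hA : A.Nonempty) (m : Fin 2) :
    ∫ z, freshTagged A m z ∂(tick q12 q21 lam ls ν) =
      ∫ z, freshTagged A m z ∂ν +
        (-(recMatrix q12 q21 (alphaRate n ls A.card) (betaRate n lam A.card)).mulVec
          (fun m => ∫ z, freshTagged A m z ∂ν) m +
        ((![q21 * ∫ z, modeInd n 1 z ∂ν, q12 * ∫ z, modeInd n 0 z ∂ν] m +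
          alphaRate n ls A.card * ∫ z, modeInd n m z ∂ν) +
        A.card * lam / ((n : ℝ) - 1) * ∑ i ∈ Aᶜ, ∫ z, freshTagged (insert i A) m z ∂ν)) /
        totalRate n q12 q21 lam ls := by
  have hF : ∀ A m, Integrable (freshTagged A m) ν := fun A m =>
    integrable_of_abs_le (abs_freshTagged_le A m)
  have hM : ∀ m, Integrable (modeInd n m) ν := fun m => integrable_of_abs_le (abs_modeInd_le m)
  have hne := h.totalRate_pos.ne'
  rw [h.integral_tick (abs_freshTagged_le A m), integral_congr_ae
    (hν.mono fun z hz => sum_rate_mul_freshTagged hA hz q12 q21 lam ls m), eq_comm,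
    add_div' _ _ _ hne]
  congr 1
  have hS : Integrable (fun z => ∑ i ∈ Aᶜ, freshTagged (insert i A) m z) ν :=
    integrable_finsetSum _ fun i _ => hF _ _
  have hW : ∀ W : Matrix (Fin 2) (Fin 2) ℝ,
      Integrable (fun z => W.mulVec (fun m => freshTagged A m z) m) ν ∧
      ∫ z, W.mulVec (fun m => freshTagged A m z) m ∂ν =
        W.mulVec (fun m => ∫ z, freshTagged A m z ∂ν) m := fun W => by
    have hi : ∀ j ∈ Finset.univ, Integrable (fun z => W m j * freshTagged A j z) ν :=
      fun j _ => (hF A j).const_mul _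
    refine ⟨integrable_finsetSum _ hi, ?_⟩
    simp only [Matrix.mulVec, dotProduct]
    rw [integral_finsetSum _ hi]
    simp only [integral_const_mul]
  have hV : Integrable (fun z => ![q21 * modeInd n 1 z, q12 * modeInd n 0 z] m) ν ∧
      ∫ z, ![q21 * modeInd n 1 z, q12 * modeInd n 0 z] m ∂ν =
        ![q21 * ∫ z, modeInd n 1 z ∂ν, q12 * ∫ z, modeInd n 0 z ∂ν] m := by
    fin_cases m
    · exact ⟨(hM 1).const_mul q21, integral_const_mul _ _⟩
    · exact ⟨(hM 0).const_mul q12, integral_const_mul _ _⟩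
  have hD := (hF A m).const_mul (totalRate n q12 q21 lam ls)
  have hH := (hM m).const_mul (alphaRate n ls A.card)
  have hWi := hW (recMatrix q12 q21 (alphaRate n ls A.card) (betaRate n lam A.card))
  have hDW : Integrable (fun z => totalRate n q12 q21 lam ls * freshTagged A m z -
      (recMatrix q12 q21 (alphaRate n ls A.card) (betaRate n lam A.card)).mulVec
        (fun m => freshTagged A m z) m) ν := hD.sub hWi.1
  rw [integral_add (hDW.fun_add (hV.1.fun_add hH)) (hS.const_mul _),
    integral_add hDW (hV.1.fun_add hH), integral_sub hD hWi.1, integral_add hV.1 hH,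
    hWi.2, hV.2, integral_const_mul, integral_const_mul, integral_const_mul,
    integral_finsetSum _ fun i _ => hF _ _]
  ring

/-- Induction step of the hierarchy: once the larger sets and the source have converged, the pair of
expectations for `A` follows a contracting affine iteration whose forcing converges. -/
theorem Admissible.tendsto_integral_freshTagged_of_insert (h : Admissible n q12 q21 lam ls)
    {ν : Measure (NetState n)} [IsProbabilityMeasure ν] (hν : ∀ᵐ z ∂ν, z.Consistent)
    {A : Finset (Fin n)} (hA : A.Nonempty)
    (hins : ∀ i ∈ Aᶜ, ∀ m, Tendsto
      (fun t => ∫ z, freshTagged (insert i A) m z ∂((tick q12 q21 lam ls)^[t] ν)) atTop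
      (𝓝 (freshRec n q12 q21 lam ls (A.card + 1) m))) (m : Fin 2) :
    Tendsto (fun t => ∫ z, freshTagged A m z ∂((tick q12 q21 lam ls)^[t] ν)) atTop
      (𝓝 (freshRec n q12 q21 lam ls A.card m)) := by
  have hpos := h.totalRate_pos
  have hne := hpos.ne'
  have hk := hA.card_pos
  have hkn := card_finset_fin_le A
  have hα := alphaRate_pos (by omega : 0 < n) hk h.ls_pos
  have hβ := betaRate_nonneg h.two_le h.lam_pos.le hkn
  have hle := h.alphaRate_add_betaRate_le hk hkn
  have hrec := recMatrix_mulVec_freshRec h.q12_pos h.q21_pos h.lam_pos h.ls_pos hk hkn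
  have hprob := h.isProbabilityMeasure_tick_iterate ν
  have hstep := fun t m =>
    h.integral_freshTagged_tick (ae_consistent_tick_iterate (q12 := q12) (q21 := q21)
      (lam := lam) (ls := ls) hν t) hA m
  simp only [← Function.iterate_succ_apply' (tick q12 q21 lam ls)] at hstep
  have hsum : ∀ m, Tendsto (fun t => A.card * lam / ((n : ℝ) - 1) *
      ∑ i ∈ Aᶜ, ∫ z, freshTagged (insert i A) m z ∂((tick q12 q21 lam ls)^[t] ν)) atTop
      (𝓝 (betaRate n lam A.card * freshRec n q12 q21 lam ls (A.card + 1) m)) := fun m => by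
    -- The `n - |A|` summands share one limit, and `(n - |A|) · |A| lam / (n - 1)` is `β_{|A|}`.
    convert (tendsto_finsetSum Aᶜ fun i hi => hins i hi m).const_mul
      (A.card * lam / ((n : ℝ) - 1)) using 2
    rw [Finset.sum_const, nsmul_eq_mul, Finset.card_compl, Fintype.card_fin, Nat.cast_sub hkn,
      betaRate]
    ring
  have hP := fun m => h.tendsto_integral_modeInd (ν := ν) m
  generalize alphaRate n ls A.card = α at *
  generalize betaRate n lam A.card = β at *
  have hd0 := ((((hP 1).const_mul q21).add ((hP 0).const_mul α)).add (hsum 0)).div_const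
    (totalRate n q12 q21 lam ls)
  have hd1 := ((((hP 0).const_mul q12).add ((hP 1).const_mul α)).add (hsum 1)).div_const
    (totalRate n q12 q21 lam ls)
  have hq12 := h.q12_pos
  have hq21 := h.q21_pos
  -- The parameters are read off `W_k/Λ`. The contraction margin `s` is positive even for the full
  -- set, where `β = 0`, because `α > 0`.
  have hlim := tendsto_of_affine_iteration
    (p := q12 / totalRate n q12 q21 lam ls) (r := q21 / totalRate n q12 q21 lam ls)
    (s := (α + β) / totalRate n q12 q21 lam ls)
    (x := fun t => ∫ z, freshTagged A 0 z ∂((tick q12 q21 lam ls)^[t] ν))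
    (y := fun t => ∫ z, freshTagged A 1 z ∂((tick q12 q21 lam ls)^[t] ν))
    (X := freshRec n q12 q21 lam ls A.card 0) (Y := freshRec n q12 q21 lam ls A.card 1)
    (by positivity) (by positivity) (by positivity)
    (by rw [← add_div, div_le_one hpos]; linarith) (by rw [← add_div, div_le_one hpos]; linarith)
    hd0 hd1 ?_ ?_ ?_ ?_
  · fin_cases m
    · exact hlim.1
    · exact hlim.2
  · intro t
    rw [hstep]
    simp [recMatrix, Matrix.mulVec, dotProduct, Fin.sum_univ_two]
    ring
  · intro t
    rw [hstep]
    simp [recMatrix, Matrix.mulVec, dotProduct, Fin.sum_univ_two]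
    ring
  · have := congrFun hrec 0
    simp [recMatrix, recVec, Matrix.mulVec, dotProduct, Fin.sum_univ_two] at this
    rw [← this]
    ring
  · have := congrFun hrec 1
    simp [recMatrix, recVec, Matrix.mulVec, dotProduct, Fin.sum_univ_two] at this
    rw [← this]
    ring

/-- Along the ticks, `E[F_A 1{Q = m}]` converges to the value of the recursion at `|A|`. -/
theorem Admissible.tendsto_integral_freshTagged (h : Admissible n q12 q21 lam ls)
    {ν : Measure (NetState n)} [IsProbabilityMeasure ν] (hν : ∀ᵐ z ∂ν, z.Consistent)
    {A : Finset (Fin n)} (hA : A.Nonempty) (m : Fin 2) :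
    Tendsto (fun t => ∫ z, freshTagged A m z ∂((tick q12 q21 lam ls)^[t] ν)) atTop
      (𝓝 (freshRec n q12 q21 lam ls A.card m)) := by
  induction hj : n - A.card generalizing A m with
  -- `A` is the full set: its complement is empty, so the hypothesis on larger sets is vacuous.
  | zero =>
    refine h.tendsto_integral_freshTagged_of_insert hν hA (fun i hi => ?_) m
    have := Finset.card_pos.2 ⟨i, hi⟩
    rw [Finset.card_compl, Fintype.card_fin] at this
    omega
  | succ j ih =>
    refine h.tendsto_integral_freshTagged_of_insert hν hA (fun i hi m => ?_) m
    have hc := Finset.card_insert_of_notMem (Finset.mem_compl.1 hi)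
    rw [← hc]
    exact ih (Finset.insert_nonempty i A) m (by omega)

/-! ### Accuracies in continuous time -/

theorem NetState.acc_mem_Icc (z : NetState n) (i : Fin n) : 0 ≤ z.acc i ∧ z.acc i ≤ 1 := by
  unfold NetState.acc
  split_ifs <;> simp

theorem NetState.abs_avgAcc_le (A : Finset (Fin n)) (z : NetState n) : |z.avgAcc A| ≤ 1 := by
  rw [NetState.avgAcc, abs_of_nonneg (div_nonneg
    (Finset.sum_nonneg fun i _ => (z.acc_mem_Icc i).1) A.card.cast_nonneg)]
  refine div_le_one_of_le₀ ?_ A.card.cast_nonneg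
  simpa using Finset.sum_le_card_nsmul A z.acc 1 fun i _ => (z.acc_mem_Icc i).2

theorem abs_tagged_le {ψ : NetState n → ℝ} (hψ : ∀ z, |ψ z| ≤ 1) (m : Fin 2) (z : NetState n) :
    |if z.mode = m then ψ z else 0| ≤ 1 := by
  split_ifs
  · exact hψ z
  · simp

theorem Admissible.tendsto_modeTagged_freshAcc (h : Admissible n q12 q21 lam ls)
    {ν : Measure (NetState n)} [IsProbabilityMeasure ν] (hν : ∀ᵐ z ∂ν, z.Consistent)
    {A : Finset (Fin n)} (hA : A.Nonempty) :
    Tendsto (modeTagged q12 q21 lam ls ν (NetState.freshAcc A)) atTop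
      (𝓝 (freshRec n q12 q21 lam ls A.card)) :=
  tendsto_pi_nhds.2 fun m => h.tendsto_integral_law (abs_freshTagged_le A m)
    (h.tendsto_integral_freshTagged hν hA m)

/-- `C_A` is the mean of `F_{i}` over `i ∈ A`, and all these singletons have the same limit. -/
theorem Admissible.tendsto_modeTagged_avgAcc (h : Admissible n q12 q21 lam ls)
    {ν : Measure (NetState n)} [IsProbabilityMeasure ν] (hν : ∀ᵐ z ∂ν, z.Consistent)
    {A : Finset (Fin n)} (hA : A.Nonempty) :
    Tendsto (modeTagged q12 q21 lam ls ν (NetState.avgAcc A)) atTop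
      (𝓝 (freshRec n q12 q21 lam ls 1)) := by
  refine tendsto_pi_nhds.2 fun m => h.tendsto_integral_law
    (abs_tagged_le (NetState.abs_avgAcc_le A) m) ?_
  have hA' : (A.card : ℝ) ≠ 0 := by simpa using hA.ne_empty
  have e : ∀ z : NetState n, (if z.mode = m then z.avgAcc A else 0) =
      (∑ i ∈ A, freshTagged {i} m z) / (A.card : ℝ) := fun z => by
    simp only [freshTagged, NetState.freshAcc_singleton, NetState.avgAcc]
    split_ifs <;> simp
  have hlim := (tendsto_finsetSum A fun i _ =>
    h.tendsto_integral_freshTagged hν (Finset.singleton_nonempty i) m).div_const (A.card : ℝ)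
  simp only [Finset.card_singleton, Finset.sum_const, nsmul_eq_mul] at hlim
  rw [mul_div_cancel_left₀ _ hA'] at hlim
  refine hlim.congr fun t => ?_
  have := h.isProbabilityMeasure_tick_iterate ν t
  simp only [e]
  rw [integral_div, integral_finsetSum _ fun i _ => integrable_of_abs_le (abs_freshTagged_le {i} m)]

theorem Admissible.tendsto_integral_law_of_modeTagged (h : Admissible n q12 q21 lam ls)
    {ν : Measure (NetState n)} [IsProbabilityMeasure ν] {ψ : NetState n → ℝ}
    (hψ : ∀ z, |ψ z| ≤ 1) {v : Fin 2 → ℝ}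
    (hv : Tendsto (modeTagged q12 q21 lam ls ν ψ) atTop (𝓝 v)) :
    Tendsto (fun t => ∫ z, ψ z ∂(law q12 q21 lam ls ν t)) atTop (𝓝 (∑ m, v m)) := by
  refine (tendsto_finsetSum Finset.univ fun m _ => tendsto_pi_nhds.1 hv m).congr' ?_
  filter_upwards [eventually_ge_atTop 0] with t ht
  have := h.isProbabilityMeasure_law ν ht
  simp only [modeTagged]
  rw [← integral_finsetSum _ fun m _ => integrable_of_abs_le (abs_tagged_le hψ m)]
  simp

end GossipNetwork

open GossipNetwork in
theorem mainTheorem8 (n : ℕ) (hn : 2 ≤ n) (q12 q21 lam : ℝ)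
    (hq12 : 0 < q12) (hq21 : 0 < q21) (hlam : 0 < lam) :
    ∃ (c f₂ : ℝ → Fin 2 → ℝ) (c₀ f₂₀ : Fin 2 → ℝ),
      -- the limits defining the accuracies exist for every push rate, initial law and node set
      (∀ ls : ℝ, 0 < ls → ∀ ν : Measure (NetState n), IsProbabilityMeasure ν →
        (∀ᵐ z ∂ν, z.Consistent) →
          (∀ A : Finset (Fin n), A.Nonempty →
            Tendsto (modeTagged q12 q21 lam ls ν (NetState.avgAcc A)) atTop (𝓝 (c ls)) ∧
            Tendsto (fun t => ∫ z, NetState.avgAcc A z ∂(law q12 q21 lam ls ν t)) atTop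
              (𝓝 (∑ m, c ls m))) ∧
          (∀ A : Finset (Fin n), A.card = 2 →
            Tendsto (modeTagged q12 q21 lam ls ν (NetState.freshAcc A)) atTop (𝓝 (f₂ ls)))) ∧
      -- the limit of `f₂` exists and is given by the recursion with all `α_k = 0`
      Tendsto f₂ (𝓝[>] 0) (𝓝 f₂₀) ∧
      f₂₀ = freshRec n q12 q21 lam 0 2 ∧
      -- `c` converges to the unique solution of the limiting system
      Tendsto c (𝓝[>] 0) (𝓝 c₀) ∧
      (∀ x : Fin 2 → ℝ,
        Matrix.mulVec !![q12 + lam, q21; q12, q21 + lam] x =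
            ![q21 * sourcePi q12 q21 1, q12 * sourcePi q12 q21 0] + lam • f₂₀ ↔ x = c₀) ∧
      Tendsto (fun ls => ∑ m, c ls m) (𝓝[>] 0) (𝓝 (∑ m, c₀ m)) := by
  have hadm : ∀ ls : ℝ, 0 < ls → Admissible n q12 q21 lam ls := fun ls hls =>
    ⟨hn, hq12, hq21, hlam, hls⟩
  -- The small-push limits are the recursion evaluated at `ls = 0`.
  have hcont : ∀ k, 0 < k → k ≤ n → Tendsto (fun ls => freshRec n q12 q21 lam ls k) (𝓝[>] 0)
      (𝓝 (freshRec n q12 q21 lam 0 k)) := fun k hk hkn =>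
    (continuousAt_freshRec hq12 hq21 hlam hk hkn).tendsto.mono_left nhdsWithin_le_nhds
  refine ⟨fun ls => freshRec n q12 q21 lam ls 1, fun ls => freshRec n q12 q21 lam ls 2,
    freshRec n q12 q21 lam 0 1, freshRec n q12 q21 lam 0 2, fun ls hls ν hν hc => ⟨fun A hA => ?_,
    fun A hA => ?_⟩, hcont 2 two_pos hn, rfl, hcont 1 one_pos (by omega), fun x => ?_, ?_⟩
  · have h := (hadm ls hls).tendsto_modeTagged_avgAcc hc hA
    exact ⟨h, (hadm ls hls).tendsto_integral_law_of_modeTagged (NetState.abs_avgAcc_le A) h⟩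
  · simpa only [hA] using
      (hadm ls hls).tendsto_modeTagged_freshAcc hc (Finset.card_pos.1 (by omega : 0 < A.card))
  · have hn1 : (n : ℝ) - 1 ≠ 0 := by
      have : (2 : ℝ) ≤ n := by exact_mod_cast hn
      linarith
    -- For a singleton without pushes `W_1` is the matrix of the limiting system, invertible since
    -- `lam > 0`; this gives uniqueness.
    have hβ : betaRate n lam 1 = lam := by
      rw [betaRate, Nat.cast_one, one_mul]
      field_simp
    have hα : alphaRate n 0 1 = 0 := by simp [alphaRate]
    have h := recMatrix_mulVec_eq_iff (α := 0) (β := lam) hq12 hq21 (by linarith) x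
      (recVec q12 q21 0 + lam • freshRec n q12 q21 lam 0 2)
    rw [freshRec_of_lt (k := 1) (by omega), hα, hβ, ← h]
    simp [recMatrix, recVec]
  · exact tendsto_finsetSum _ fun m _ => tendsto_pi_nhds.1 (hcont 1 one_pos (by omega)) m
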